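/- **Theorem 7.1 (limit points of geodesics).** Let $\mathcal A$ be a unital $C^*$-algebra and $\mathcal D=\{z\in\mathcal A:\|z\|<1\}$ its Poincaré disk. Embed $\mathcal D$ in the positive invertible elements of $M_2(\mathcal A)$ by $$\Phi(z)=\begin{pmatrix}2(1-z^*z)^{-1}-1 & -2(1-z^*z)^{-1}z^*\\ -2z(1-z^*z)^{-1} & 2z(1-z^*z)^{-1}z^*+1\end{pmatrix}.$$ A geodesic of $\mathcal D$ is a $C^2$ curve $\delta:\mathbb R\to\mathcal D$ such that $\gamma=\Phi\circ\delta$ is a geodesic of the natural connection $\frac{DX}{dt}=X'-\frac12(\gamma'\gamma^{-1}X+X\gamma^{-1}\gamma')$ of the space of positive invertible elements of $M_2(\mathcal A)$, i.e. $\frac{D\gamma'}{dt}=0$. Let $\pi:\mathcal A\to B(H)$ be the universal representation (the direct sum of the GNS representations of all states of $\mathcal A$), and let $\mathcal A^{**}=\pi(\mathcal A)''\subset B(H)$ be the bidual of $\mathcal A$, realised as its enveloping von Neumann algebra. Let $z\in\mathcal D$. Then: 1. there is a unique geodesic $\delta$ of $\mathcal D$ with $\delta(0)=0$ and $\delta(1)=z$;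 2. $z$ has a unique polar decomposition in $\mathcal A^{**}$: there is a unique partial isometry $\omega\in\mathcal A^{**}$ with $\pi(z)=\omega|\pi(z)|$ and $\ker\omega=\ker\pi(z)$; 3. for this geodesic $\delta$ and this partial isometry $\omega$, $$\mathrm{SOT}\text{-}\lim_{t\to+\infty}\pi(\delta(t))=\omega\qquad\text{and}\qquad \mathrm{SOT}\text{-}\lim_{t\to-\infty}\pi(\delta(t))=-\omega,$$ where SOT is the strong operator topology of $B(H)$. -/

import Mathlib

open Filter Topology
open scoped ENNReal ComplexOrder

/-! ### Geodesics of the Poincaré disk of a unital C⋆-algebra -/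

namespace PoincareDisk

section Geodesics

variable {A : Type*} [CStarAlgebra A] [PartialOrder A] [StarOrderedRing A]

/-- The embedding `Φ` of the disk `{z : ‖z‖ < 1}` into the positive invertible elements of the
C⋆-algebra `M₂(A)`:
`Φ z = [[2(1 - z*z)⁻¹ - 1, -2(1 - z*z)⁻¹z*], [-2z(1 - z*z)⁻¹, 2z(1 - z*z)⁻¹z* + 1]]`.
For `‖z‖ < 1` the element `1 - z*z` is invertible and `Ring.inverse` is its inverse. -/
noncomputable def embedding (z : A) : CStarMatrix (Fin 2) (Fin 2) A :=
  CStarMatrix.ofMatrix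
    !![(2 : ℝ) • Ring.inverse (1 - star z * z) - 1,
        -((2 : ℝ) • (Ring.inverse (1 - star z * z) * star z));
      -((2 : ℝ) • (z * Ring.inverse (1 - star z * z))),
        (2 : ℝ) • (z * Ring.inverse (1 - star z * z) * star z) + 1]

/-- The covariant derivative of the natural connection of the space of positive invertible
elements of a C⋆-algebra, for a vector field `X` along a curve `γ` of positive invertible elements:
`DX/dt = X' - (γ' γ⁻¹ X + X γ⁻¹ γ') / 2`. -/
noncomputable def covDeriv {B : Type*} [CStarAlgebra B] (γ X : ℝ → B) (t : ℝ) : B :=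
  deriv X t - (1 / 2 : ℝ) •
    (deriv γ t * Ring.inverse (γ t) * X t + X t * Ring.inverse (γ t) * deriv γ t)

/-- The geodesic equation in the space of positive invertible elements of a C⋆-algebra: the
covariant derivative of the velocity field vanishes, `Dγ'/dt = γ'' - γ' γ⁻¹ γ' = 0`. -/
def SatisfiesGeodesicEquation {B : Type*} [CStarAlgebra B] (γ : ℝ → B) : Prop :=
  ∀ t, covDeriv γ (deriv γ) t = 0

/-- A curve `δ : ℝ → A` is a geodesic of the disk `{z : ‖z‖ < 1}` if it stays in the disk, is of
class `C²`, and its image under the embedding of the disk into the positive invertible elements of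
`M₂(A)` satisfies the geodesic equation there.  (The image of the disk is totally geodesic, so
these are the geodesics of the connection which the disk inherits through the embedding.) -/
structure IsGeodesic (δ : ℝ → A) : Prop where
  norm_lt_one : ∀ t, ‖δ t‖ < 1
  contDiff : ContDiff ℝ 2 δ
  geodesic_equation : SatisfiesGeodesicEquation fun t => embedding (δ t)

end Geodesics

/-! ### The universal representation and the enveloping von Neumann algebra -/

section Universal

variable (A : Type*) [CStarAlgebra A] [PartialOrder A] [StarOrderedRing A]

/-- The states of a unital C⋆-algebra: the positive linear functionals `f` with `f 1 = 1`. -/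
abbrev States : Type _ := {f : A →ₚ[ℂ] ℂ // f 1 = 1}

/-- The Hilbert space of the universal representation: the Hilbert sum of the GNS spaces of all
states. -/
abbrev UniversalSpace : Type _ := lp (fun f : States A => f.1.GNS) 2

/-- The universal representation of a unital C⋆-algebra: the direct sum of the GNS representations
of all states. -/
noncomputable def universalRep : A →⋆ₐ[ℂ] (UniversalSpace A →L[ℂ] UniversalSpace A) where
  toFun a := lp.mapCLM 2 (fun f : States A => f.1.gnsStarAlgHom a) (norm_nonneg a)
    (fun f => NonUnitalStarAlgHom.norm_apply_le f.1.gnsStarAlgHom a)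
  map_one' := by
    ext x i
    simp only [lp.mapCLM_apply_coe, map_one]
    rfl
  map_mul' a b := by
    ext x i
    simp only [lp.mapCLM_apply_coe, map_mul]
    rfl
  map_zero' := by
    ext x i
    simp only [lp.mapCLM_apply_coe, map_zero]
    rfl
  map_add' a b := by
    ext x i
    simp only [lp.mapCLM_apply_coe, map_add]
    rfl
  commutes' r := by
    ext x i
    simp only [lp.mapCLM_apply_coe, AlgHomClass.commutes]
    rfl
  map_star' a := by
    refine (ContinuousLinearMap.eq_adjoint_iff _ _).mpr fun x y => ?_
    simp only [lp.inner_eq_tsum]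
    refine tsum_congr fun i => ?_
    simp only [lp.mapCLM_apply_coe, map_star, ContinuousLinearMap.star_eq_adjoint]
    exact ContinuousLinearMap.adjoint_inner_left _ _ _

/-- The bidual `A**` of a unital C⋆-algebra, realised as its enveloping von Neumann algebra: the
double commutant of the image of the universal representation. -/
noncomputable def enveloping : VonNeumannAlgebra (UniversalSpace A) where
  toStarSubalgebra := StarSubalgebra.centralizer ℂ (StarSubalgebra.centralizer ℂ
    (Set.range (universalRep A)) : Set (UniversalSpace A →L[ℂ] UniversalSpace A))
  centralizer_centralizer' := by
    simp

end Universal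

/-! ### Polar decomposition -/

/-- `ω` is the partial isometry of the polar decomposition of a bounded operator `T` on a Hilbert
space: `ω` is a partial isometry, `T = ω |T|` with `|T| = (T*T)^{1/2}`, and the initial space of
`ω` is the orthogonal complement of the kernel of `T`, i.e. `ω` and `T` have the same kernel. -/
structure IsPolarPart {H : Type*} [NormedAddCommGroup H] [InnerProductSpace ℂ H] [CompleteSpace H]
    (T ω : H →L[ℂ] H) : Prop where
  isPartialIsometry : ω * star ω * ω = ω
  eq_mul_abs : T = ω * CFC.abs T
  ker_eq : LinearMap.ker (ω : H →ₗ[ℂ] H) = LinearMap.ker (T : H →ₗ[ℂ] H)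

/-- Convergence in the strong operator topology of a family of bounded operators, along a filter. -/
def SOTTendsto {ι H : Type*} [NormedAddCommGroup H] [InnerProductSpace ℂ H]
    (T : ι → H →L[ℂ] H) (l : Filter ι) (S : H →L[ℂ] H) : Prop :=
  Tendsto (fun i => ContinuousLinearMap.toPointwiseConvergenceCLM ℂ (RingHom.id ℂ) H H (T i)) l
    (𝓝 (ContinuousLinearMap.toPointwiseConvergenceCLM ℂ (RingHom.id ℂ) H H S))

end PoincareDisk

namespace PoincareDisk

/-! ### One-parameter groups and the geodesic equation -/

section ExpGeodesic

variable {B : Type*} [CStarAlgebra B]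

/-! Write `Z = offDiag z` for the selfadjoint matrix `[[0, z*], [z, 0]]`. The embedding is its
Cayley transform, `Φ(z) = (1 - Z)(1 + Z)⁻¹ = exp(-2 artanh Z)` (`diskEmbedding_eq`). Geodesics of
invertible elements through `1` at time `0` are the one-parameter groups `exp(tV)`, and for
selfadjoint values `V` is recovered from time `1` by the logarithm. Hence the geodesic from `0` to
`z` exists, is unique, and satisfies `offDiag (δ t) = tanh(t artanh Z)`, which is off-diagonal
because the function is odd (`offDiag_entry_cfc`, `diskEmbedding_diskFlow`).

On the spectrum, `tanh(t artanh x)` tends to the sign of `x`, not uniformly near `0`; after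
multiplication by `|x|` the error is at most `2 / t`. Reading off a matrix entry gives `‖δ(t)|z| -
z‖ ≤ 2 / t`. For any representation `π` and `T = π(z)`, this settles convergence of `π(δ(t))` on the
range of `|T|`. On `ker T` every `π(δ(t))` vanishes, since `δ(t)*δ(t) ≤ C z*z`. The range and the
kernel span a dense subspace and `‖π(δ(t))‖ ≤ 1`, so the strong limit exists and is the polar part
of `T`. As a strong limit from `π(A)` it lies in the double commutant. -/

lemma ringInverse_exp (x : B) : Ring.inverse (NormedSpace.exp x) = NormedSpace.exp (-x) :=
  letI : NormedAlgebra ℚ B := NormedAlgebra.restrictScalars ℚ ℝ B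
  Ring.inverse_exp x

lemma isUnit_exp (x : B) : IsUnit (NormedSpace.exp x) :=
  letI : NormedAlgebra ℚ B := NormedAlgebra.restrictScalars ℚ ℝ B
  NormedSpace.isUnit_exp x

lemma contDiff_exp_smul (V : B) : ContDiff ℝ 2 fun t : ℝ => NormedSpace.exp (t • V) := by
  have h : ContDiff ℝ 2 (NormedSpace.exp : B → B) :=
    contDiff_iff_contDiffAt.mpr fun x => (NormedSpace.exp_analytic (𝕂 := ℝ) x).contDiffAt
  exact h.comp (contDiff_id.smul contDiff_const)

lemma satisfiesGeodesicEquation_exp_smul (V : B) :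
    SatisfiesGeodesicEquation fun t : ℝ => NormedSpace.exp (t • V) := by
  intro t
  have h1 : deriv (fun t : ℝ => NormedSpace.exp (t • V)) =
      fun t : ℝ => V * NormedSpace.exp (t • V) :=
    funext fun s => (hasDerivAt_exp_smul_const' V s).deriv
  have h2 : deriv (fun t : ℝ => V * NormedSpace.exp (t • V)) t =
      V * (V * NormedSpace.exp (t • V)) :=
    ((hasDerivAt_exp_smul_const' V t).const_mul V).deriv
  have h3 : NormedSpace.exp (t • V) * Ring.inverse (NormedSpace.exp (t • V)) = 1 :=
    Ring.mul_inverse_cancel _ (isUnit_exp _)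
  have h4 : V * NormedSpace.exp (t • V) * Ring.inverse (NormedSpace.exp (t • V)) *
      (V * NormedSpace.exp (t • V)) = V * (V * NormedSpace.exp (t • V)) := by
    rw [mul_assoc V, h3, mul_one]
  rw [covDeriv, h1, h2, h4, ← two_smul ℝ, smul_smul]
  norm_num

/-- A geodesic of invertible elements which starts at `1` is a one-parameter group. -/
lemma SatisfiesGeodesicEquation.eq_exp_smul {γ : ℝ → B} (hγ : SatisfiesGeodesicEquation γ)
    (hC : ContDiff ℝ 2 γ) (hu : ∀ t, IsUnit (γ t)) (h0 : γ 0 = 1) (t : ℝ) :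
    γ t = NormedSpace.exp (t • deriv γ 0) := by
  have hd : ∀ t, HasDerivAt γ (deriv γ t) t := fun t =>
    ((hC.differentiable (by norm_num)) t).hasDerivAt
  have hdd : ∀ t, HasDerivAt (deriv γ) (deriv γ t * Ring.inverse (γ t) * deriv γ t) t := by
    intro t
    have h1 : Differentiable ℝ (deriv γ) :=
      (ContDiff.differentiable_deriv_two hC)
    have h2 := hγ t
    rw [covDeriv, ← two_smul ℝ, smul_smul, sub_eq_zero] at h2
    norm_num at h2
    rw [← h2]
    exact (h1 t).hasDerivAt
  have hinv : ∀ t, HasDerivAt (fun s => Ring.inverse (γ s))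
      (-(Ring.inverse (γ t) * deriv γ t * Ring.inverse (γ t))) t := by
    intro t
    obtain ⟨u, hu⟩ := hu t
    have h := hasFDerivAt_ringInverse (𝕜 := ℝ) u
    rw [hu] at h
    refine (h.comp_hasDerivAt t (hd t)).congr_deriv ?_
    simp [← hu]
  set V := deriv γ 0 with hV
  -- Conserved quantity: `γ'' = γ' γ⁻¹ γ'` makes the derivative of `γ' γ⁻¹` cancel, leaving the
  -- linear equation `γ' = V γ`.
  have hfirst : ∀ t, deriv γ t * Ring.inverse (γ t) = V := by
    intro t
    have hF : ∀ t, HasDerivAt (fun s => deriv γ s * Ring.inverse (γ s)) 0 t := fun t => by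
      refine ((hdd t).mul (hinv t)).congr_deriv ?_
      noncomm_ring
    have := is_const_of_deriv_eq_zero (fun t => (hF t).differentiableAt)
      (fun t => (hF t).deriv) t 0
    simpa [h0] using this
  have hode : ∀ t, deriv γ t = V * γ t := fun t => by
    rw [← hfirst t, mul_assoc, Ring.inverse_mul_cancel _ (hu t), mul_one]
  have hG : ∀ t, HasDerivAt (fun s : ℝ => NormedSpace.exp (s • (-V)) * γ s) 0 t := fun t => by
    refine ((hasDerivAt_exp_smul_const (-V) t).mul (hd t)).congr_deriv ?_
    rw [hode]
    noncomm_ring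
  have hc := is_const_of_deriv_eq_zero (fun t => (hG t).differentiableAt)
      (fun t => (hG t).deriv) t 0
  simp only [h0, zero_smul, NormedSpace.exp_zero, mul_one] at hc
  have hi : NormedSpace.exp (t • V) * NormedSpace.exp (t • -V) = 1 := by
    rw [smul_neg, ← ringInverse_exp, Ring.mul_inverse_cancel _ (isUnit_exp _)]
  rw [← mul_one (NormedSpace.exp (t • V)), ← hc, ← mul_assoc, hi, one_mul]

/-- Two geodesics of selfadjoint invertible elements which agree at times `0` and `1`, where they
are `1` at time `0`, are equal. -/
lemma SatisfiesGeodesicEquation.eq_of_eq_one {γ₁ γ₂ : ℝ → B}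
    (h₁ : SatisfiesGeodesicEquation γ₁) (h₂ : SatisfiesGeodesicEquation γ₂)
    (hC₁ : ContDiff ℝ 2 γ₁) (hC₂ : ContDiff ℝ 2 γ₂)
    (hu₁ : ∀ t, IsUnit (γ₁ t)) (hu₂ : ∀ t, IsUnit (γ₂ t))
    (hs₁ : ∀ t, IsSelfAdjoint (γ₁ t)) (hs₂ : ∀ t, IsSelfAdjoint (γ₂ t))
    (h0₁ : γ₁ 0 = 1) (h0₂ : γ₂ 0 = 1) (h : γ₁ 1 = γ₂ 1) : γ₁ = γ₂ := by
  -- Selfadjointness of the initial velocity is what allows `CFC.log` to invert the exponential at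
  -- time `1`.
  have key : ∀ {γ : ℝ → B}, ContDiff ℝ 2 γ → (∀ t, IsSelfAdjoint (γ t)) →
      IsSelfAdjoint (deriv γ 0) := by
    intro γ hC hs
    have hd : HasDerivAt γ (deriv γ 0) 0 := ((hC.differentiable (by norm_num)) 0).hasDerivAt
    have hst := hd.star
    rw [show (fun x => star (γ x)) = γ from funext fun t => (hs t).star_eq] at hst
    exact hst.unique hd
  have e₁ := h₁.eq_exp_smul hC₁ hu₁ h0₁
  have e₂ := h₂.eq_exp_smul hC₂ hu₂ h0₂
  have hV : deriv γ₁ 0 = deriv γ₂ 0 := by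
    have := e₁ 1
    rw [h, e₂ 1, one_smul, one_smul] at this
    rw [← CFC.log_exp (deriv γ₁ 0) (key hC₁ hs₁), ← this,
      CFC.log_exp (deriv γ₂ 0) (key hC₂ hs₂)]
  funext t
  rw [e₁, e₂, hV]

end ExpGeodesic

/-! ### The flow of the disk on real points -/

section TanhFlow

/-- The geodesic flow on the real points of the disk: `x = tanh s` is moved to `tanh (t s)`. -/
noncomputable def tanhFlow (t x : ℝ) : ℝ := Real.tanh (t * Real.artanh x)

/-- Scalar Cayley relation: through the functional calculus it becomes `(1 + offDiag (δ t)) (1 +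
exp(tV)) = 2`. It also drives the estimates on `tanh` below. -/
lemma one_add_tanh_mul (u : ℝ) : (1 + Real.tanh u) * (1 + Real.exp (-2 * u)) = 2 := by
  have h : Real.exp (-2 * u) = Real.exp (-u) * Real.exp (-u) := by rw [← Real.exp_add]; ring_nf
  rw [Real.tanh_eq, h, Real.exp_neg]
  have := Real.exp_pos u
  field_simp
  ring

lemma continuous_tanh : Continuous Real.tanh := by
  rw [show Real.tanh = fun x => Real.sinh x / Real.cosh x from
    funext Real.tanh_eq_sinh_div_cosh]
  exact Real.continuous_sinh.div Real.continuous_cosh fun x => (Real.cosh_pos x).ne'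

lemma continuousOn_artanh : ContinuousOn Real.artanh (Set.Ioo (-1) 1) := by
  have h : Set.EqOn Real.artanh (fun x => 1 / 2 * Real.log ((1 + x) / (1 - x)))
      (Set.Ioo (-1) 1) := fun x hx => Real.artanh_eq_half_log ⟨hx.1.le, hx.2.le⟩
  refine ContinuousOn.congr ?_ h
  refine continuousOn_const.mul (ContinuousOn.log
    (ContinuousOn.div (by fun_prop) (by fun_prop) ?_) ?_)
  · intro x hx; linarith [hx.2]
  · intro x hx
    exact (div_pos (by linarith [hx.1]) (by linarith [hx.2])).ne'

lemma continuousOn_tanhFlow (t : ℝ) : ContinuousOn (tanhFlow t) (Set.Ioo (-1) 1) :=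
  continuous_tanh.comp_continuousOn (continuousOn_const.mul continuousOn_artanh)

lemma artanh_neg_eq (x : ℝ) : Real.artanh (-x) = -Real.artanh x := by
  rw [Real.artanh, Real.artanh, ← Real.log_inv, ← Real.sqrt_inv, inv_div]
  congr 3
  ring

lemma tanhFlow_neg_right (t x : ℝ) : tanhFlow t (-x) = -tanhFlow t x := by
  rw [tanhFlow, tanhFlow, artanh_neg_eq, mul_neg, Real.tanh_neg]

lemma tanhFlow_neg_left (t x : ℝ) : tanhFlow (-t) x = -tanhFlow t x := by
  rw [tanhFlow, tanhFlow, neg_mul, Real.tanh_neg]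

lemma tanhFlow_one {x : ℝ} (hx : x ∈ Set.Ioo (-1) 1) : tanhFlow 1 x = x := by
  rw [tanhFlow, one_mul, Real.tanh_artanh hx]

lemma abs_tanhFlow_lt_one (t x : ℝ) : |tanhFlow t x| < 1 :=
  abs_lt.mpr ⟨Real.neg_one_lt_tanh _, Real.tanh_lt_one _⟩

lemma tanh_nonneg {u : ℝ} (hu : 0 ≤ u) : 0 ≤ Real.tanh u := by
  rw [Real.tanh_eq_sinh_div_cosh]
  exact div_nonneg (Real.sinh_nonneg_iff.mpr hu) (Real.cosh_pos u).le

lemma tanh_le_two_mul {u : ℝ} (hu : 0 ≤ u) : Real.tanh u ≤ 2 * u := by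
  have h := one_add_tanh_mul u
  have h1 := Real.add_one_le_exp (-2 * u)
  have h2 := tanh_nonneg hu
  have h3 := Real.exp_pos (-2 * u)
  nlinarith

lemma abs_tanh_le (u : ℝ) : |Real.tanh u| ≤ 2 * |u| := by
  rcases le_total 0 u with hu | hu
  · rw [abs_of_nonneg hu, abs_of_nonneg (tanh_nonneg hu)]
    exact tanh_le_two_mul hu
  · have hu' : 0 ≤ -u := neg_nonneg.mpr hu
    rw [abs_of_nonpos hu, ← abs_neg, ← Real.tanh_neg, abs_of_nonneg (tanh_nonneg hu')]
    exact tanh_le_two_mul hu'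

/-- The gap `1 - tanh u` is at most `2 exp(-2u)`, and `exp(2u) ≥ 1 + 2u` absorbs the factor `u`. -/
lemma one_sub_tanh_mul_le {u : ℝ} (hu : 0 ≤ u) : (1 - Real.tanh u) * u ≤ 1 := by
  have h := one_add_tanh_mul u
  have h1 := Real.add_one_le_exp (2 * u)
  have h2 : Real.exp (-2 * u) * Real.exp (2 * u) = 1 := by rw [← Real.exp_add]; simp
  have h3 := Real.exp_pos (-2 * u)
  have h4 := Real.tanh_lt_one u
  have h6 : 1 - Real.tanh u ≤ 2 * Real.exp (-2 * u) := by
    have h5 := tanh_nonneg hu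
    nlinarith
  have h7 : 2 * Real.exp (-2 * u) * u ≤ 1 := by nlinarith
  nlinarith

lemma abs_artanh_le {x r : ℝ} (hx : |x| ≤ r) (hr : r < 1) :
    |Real.artanh x| ≤ |x| / (1 - r) := by
  have key : ∀ y : ℝ, 0 ≤ y → y ≤ r → |Real.artanh y| ≤ y / (1 - r) := by
    intro y hy hyr
    rw [abs_of_nonneg (Real.artanh_nonneg hy), Real.artanh_eq_half_log ⟨by linarith, by linarith⟩]
    have h1 : 0 < 1 - y := by linarith
    have h2 := Real.log_le_sub_one_of_pos (show 0 < (1 + y) / (1 - y) by positivity)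
    have h3 : (1 + y) / (1 - y) - 1 = 2 * (y / (1 - y)) := by field_simp; ring
    have h4 : y / (1 - y) ≤ y / (1 - r) := by gcongr
    linarith
  rcases le_total 0 x with h | h
  · rw [abs_of_nonneg h] at hx ⊢; exact key x h hx
  · rw [abs_of_nonpos h] at hx ⊢
    rw [← abs_neg, ← artanh_neg_eq]; exact key (-x) (by linarith) hx

/-- A linear bound at the origin, uniform on `|x| ≤ r`; squared, it yields the domination of
`δ(t)*δ(t)` by `z*z`. -/
lemma abs_tanhFlow_le {x r : ℝ} (t : ℝ) (hx : |x| ≤ r) (hr : r < 1) :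
    |tanhFlow t x| ≤ 2 * |t| / (1 - r) * |x| := by
  have h1 := abs_artanh_le hx hr
  calc |tanhFlow t x| ≤ 2 * (|t| * |Real.artanh x|) := by
        rw [← abs_mul]; exact abs_tanh_le _
    _ ≤ 2 * (|t| * (|x| / (1 - r))) := by gcongr
    _ = _ := by ring

/-- The flow moves a point `x` towards the sign of `x`, at a uniform rate. -/
lemma abs_tanhFlow_mul_abs_sub_le {x t : ℝ} (hx : |x| < 1) (ht : 0 < t) :
    |tanhFlow t x * |x| - x| ≤ 2 / t := by
  have key : ∀ y : ℝ, 0 ≤ y → y < 1 → |tanhFlow t y * y - y| ≤ 2 / t := by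
    intro y hy hy1
    have h1 := Real.tanh_artanh (x := y) ⟨by linarith, hy1⟩
    have h0 := Real.artanh_nonneg hy
    have h2 := tanh_le_two_mul h0
    rw [h1] at h2
    have h3 := one_sub_tanh_mul_le (u := t * Real.artanh y) (by positivity)
    have h4 := Real.tanh_lt_one (t * Real.artanh y)
    rw [show tanhFlow t y * y - y = -((1 - Real.tanh (t * Real.artanh y)) * y) by
      rw [tanhFlow]; ring, abs_neg, abs_of_nonneg (mul_nonneg (by linarith) hy), le_div_iff₀ ht]
    -- With `s = artanh y` one has `y ≤ 2s`, so `(1 - tanh(ts)) t y ≤ 2 (1 - tanh(ts)) ts ≤ 2`: this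
    -- is the constant in `2 / t`.
    have h5 : 0 ≤ (1 - Real.tanh (t * Real.artanh y)) * t := mul_nonneg (by linarith) ht.le
    nlinarith
  rcases le_total 0 x with h | h
  · rw [abs_of_nonneg h] at hx ⊢; exact key x h hx
  · rw [abs_of_nonpos h] at hx ⊢
    have := key (-x) (by linarith) hx
    rw [tanhFlow_neg_right] at this
    rw [← abs_neg]
    convert this using 2
    ring

end TanhFlow

/-! ### The off-diagonal selfadjoint matrices -/

section OffDiag

set_option linter.unusedSectionVars false

variable {A : Type*} [CStarAlgebra A]

lemma isUnit_one_sub_star_mul_self {z : A} (hz : ‖z‖ < 1) : IsUnit (1 - star z * z) :=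
  isUnit_one_sub_of_norm_lt_one <| by
    rw [CStarRing.norm_star_mul_self]
    nlinarith [norm_nonneg z]

variable [PartialOrder A] [StarOrderedRing A]

/-- The C⋆-algebra `M₂(A)`, as a type which carries only the structure that comes from being a
C⋆-algebra. -/
def MatrixTwo (A : Type*) : Type _ := CStarMatrix (Fin 2) (Fin 2) A

namespace MatrixTwo

noncomputable instance : CStarAlgebra (MatrixTwo A) :=
  inferInstanceAs (CStarAlgebra (CStarMatrix (Fin 2) (Fin 2) A))

noncomputable instance : PartialOrder (MatrixTwo A) :=
  inferInstanceAs (PartialOrder (CStarMatrix (Fin 2) (Fin 2) A))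

instance : StarOrderedRing (MatrixTwo A) :=
  inferInstanceAs (StarOrderedRing (CStarMatrix (Fin 2) (Fin 2) A))

/-- The matrix with the given entries. -/
def mk (a b c d : A) : MatrixTwo A := CStarMatrix.ofMatrix !![a, b; c, d]

/-- The entries of a matrix. -/
def entry (M : MatrixTwo A) (i j : Fin 2) : A := (M : CStarMatrix (Fin 2) (Fin 2) A) i j

lemma ext {M N : MatrixTwo A} (h : ∀ i j, M.entry i j = N.entry i j) : M = N := CStarMatrix.ext h

@[simp] lemma entry_mk (a b c d : A) (i j : Fin 2) : (mk a b c d).entry i j = !![a, b; c, d] i j :=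
  rfl

@[simp] lemma entry_add (M N : MatrixTwo A) (i j : Fin 2) :
    (M + N).entry i j = M.entry i j + N.entry i j := rfl

@[simp] lemma entry_sub (M N : MatrixTwo A) (i j : Fin 2) :
    (M - N).entry i j = M.entry i j - N.entry i j := rfl

@[simp] lemma entry_neg (M : MatrixTwo A) (i j : Fin 2) : (-M).entry i j = -M.entry i j := rfl

@[simp] lemma entry_smul (r : ℝ) (M : MatrixTwo A) (i j : Fin 2) :
    (r • M).entry i j = r • M.entry i j := rfl

@[simp] lemma entry_zero (i j : Fin 2) : (0 : MatrixTwo A).entry i j = 0 := rfl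

lemma entry_one (i j : Fin 2) : (1 : MatrixTwo A).entry i j = if i = j then 1 else 0 := rfl

lemma entry_mul (M N : MatrixTwo A) (i j : Fin 2) :
    (M * N).entry i j = M.entry i 0 * N.entry 0 j + M.entry i 1 * N.entry 1 j := by
  refine (CStarMatrix.mul_apply (M := M) (N := N)).trans ?_
  rw [Fin.sum_univ_two]
  rfl

@[simp] lemma entry_star (M : MatrixTwo A) (i j : Fin 2) :
    (star M).entry i j = star (M.entry j i) := rfl

lemma norm_entry_le (M : MatrixTwo A) (i j : Fin 2) : ‖M.entry i j‖ ≤ ‖M‖ :=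
  CStarMatrix.norm_entry_le_norm (M := M)

/-- The lower left entry of a matrix, as a continuous linear function. -/
noncomputable def lowerLeft : MatrixTwo A →L[ℝ] A :=
  LinearMap.mkContinuous
    { toFun := fun M => M.entry 1 0, map_add' := fun _ _ => rfl, map_smul' := fun _ _ => rfl } 1
    fun M => by
      rw [one_mul]
      exact norm_entry_le M 1 0

@[simp] lemma lowerLeft_apply (M : MatrixTwo A) : lowerLeft M = M.entry 1 0 := rfl

lemma continuous_mk {X : Type*} [TopologicalSpace X] {a b c d : X → A} (ha : Continuous a)
    (hb : Continuous b) (hc : Continuous c) (hd : Continuous d) :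
    Continuous fun x => mk (a x) (b x) (c x) (d x) := by
  refine CStarMatrix.ofMatrixL.continuous.comp (continuous_pi fun i => continuous_pi fun j => ?_)
  fin_cases i <;> fin_cases j <;> simpa

lemma entry_nonneg {M : MatrixTwo A} (h : 0 ≤ M) (i : Fin 2) : 0 ≤ M.entry i i := by
  obtain ⟨S, rfl⟩ := CStarAlgebra.nonneg_iff_eq_star_mul_self.mp h
  rw [entry_mul, entry_star, entry_star]
  exact add_nonneg (star_mul_self_nonneg _) (star_mul_self_nonneg _)

lemma mk_diag_nonneg {a d : A} (ha : 0 ≤ a) (hd : 0 ≤ d) : 0 ≤ mk a 0 0 d := by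
  obtain ⟨s, rfl⟩ := CStarAlgebra.nonneg_iff_eq_star_mul_self.mp ha
  obtain ⟨t, rfl⟩ := CStarAlgebra.nonneg_iff_eq_star_mul_self.mp hd
  refine CStarAlgebra.nonneg_iff_eq_star_mul_self.mpr ⟨mk s 0 0 t, ext fun i j => ?_⟩
  rw [entry_mul]
  fin_cases i <;> fin_cases j <;> simp

end MatrixTwo

/-- The selfadjoint matrix `[[0, z*], [z, 0]]`, as a real linear function of `z`. -/
noncomputable def offDiag : A →L[ℝ] MatrixTwo A where
  toFun z := MatrixTwo.mk 0 (star z) z 0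
  map_add' x y := by
    refine MatrixTwo.ext fun i j => ?_
    fin_cases i <;> fin_cases j <;> simp
  map_smul' r x := by
    refine MatrixTwo.ext fun i j => ?_
    fin_cases i <;> fin_cases j <;> simp
  cont := MatrixTwo.continuous_mk continuous_const continuous_star continuous_id continuous_const

/-- The embedding of the disk, with values in `MatrixTwo A`. -/
noncomputable def diskEmbedding (z : A) : MatrixTwo A := embedding z

lemma diskEmbedding_apply (z : A) : diskEmbedding z =
    MatrixTwo.mk ((2 : ℝ) • Ring.inverse (1 - star z * z) - 1)
      (-((2 : ℝ) • (Ring.inverse (1 - star z * z) * star z)))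
      (-((2 : ℝ) • (z * Ring.inverse (1 - star z * z))))
      ((2 : ℝ) • (z * Ring.inverse (1 - star z * z) * star z) + 1) := rfl

lemma offDiag_apply (z : A) : offDiag z = MatrixTwo.mk 0 (star z) z 0 := rfl

@[simp] lemma offDiag_one_zero (z : A) : (offDiag z).entry 1 0 = z := rfl

lemma isSelfAdjoint_offDiag (z : A) : IsSelfAdjoint (offDiag z) := by
  rw [isSelfAdjoint_iff]
  refine MatrixTwo.ext fun i j => ?_
  fin_cases i <;> fin_cases j <;> simp [offDiag_apply]

/-- With `D = (1 - z*z)⁻¹`, the bottom row is a formal cancellation; the top row uses `(1 - z*z)D =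
1` and its right multiple by `z*`. -/
lemma one_add_offDiag_mul {z : A} (hz : ‖z‖ < 1) :
    (1 + offDiag z) * (diskEmbedding z + 1) = (2 : ℝ) • 1 := by
  have h := Ring.mul_inverse_cancel _ (isUnit_one_sub_star_mul_self hz)
  refine MatrixTwo.ext fun i j => ?_
  fin_cases i <;> fin_cases j <;>
    simp [offDiag_apply, diskEmbedding_apply, MatrixTwo.entry_mul, MatrixTwo.entry_one]
  all_goals
    generalize Ring.inverse (1 - star z * z) = D at *
    have h' := congrArg (· * star z) h
    simp only [sub_mul, mul_add, mul_smul_comm, mul_assoc, one_mul, mul_one] at h h' ⊢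
  · linear_combination (norm := module) (2 : ℝ) • h
  · linear_combination (norm := module) (-2 : ℝ) • h'
  · module

lemma diskEmbedding_add_one_mul {z : A} (hz : ‖z‖ < 1) :
    (diskEmbedding z + 1) * (1 + offDiag z) = (2 : ℝ) • 1 := by
  have h := Ring.inverse_mul_cancel _ (isUnit_one_sub_star_mul_self hz)
  refine MatrixTwo.ext fun i j => ?_
  fin_cases i <;> fin_cases j <;>
    simp [offDiag_apply, diskEmbedding_apply, MatrixTwo.entry_mul, MatrixTwo.entry_one]
  all_goals
    generalize Ring.inverse (1 - star z * z) = D at *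
    have h' := congrArg (z * ·) h
    simp only [mul_sub, add_mul, smul_mul_assoc, mul_assoc, one_mul, mul_one] at h h' ⊢
  · linear_combination (norm := module) (2 : ℝ) • h
  · linear_combination (norm := module) (-2 : ℝ) • h'
  · module

lemma isUnit_one_add_offDiag {z : A} (hz : ‖z‖ < 1) : IsUnit (1 + offDiag z) := by
  refine ⟨⟨_, (1 / 2 : ℝ) • (diskEmbedding z + 1), ?_, ?_⟩, rfl⟩
  · rw [mul_smul_comm, one_add_offDiag_mul hz, smul_smul]; norm_num
  · rw [smul_mul_assoc, diskEmbedding_add_one_mul hz, smul_smul]; norm_num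

/-- The diskEmbedding of the disk is the Cayley transform of the off-diagonal matrices. -/
lemma diskEmbedding_eq {z : A} (hz : ‖z‖ < 1) :
    diskEmbedding z = (2 : ℝ) • Ring.inverse (1 + offDiag z) - 1 := by
  have h := congrArg (Ring.inverse (1 + offDiag z) * ·) (one_add_offDiag_mul hz)
  simp only [← mul_assoc, Ring.inverse_mul_cancel _ (isUnit_one_add_offDiag hz), one_mul,
    mul_smul_comm, mul_one] at h
  rw [← h, add_sub_cancel_right]

/-- In `Φ(z) = (1 - Z)(1 + Z)⁻¹` the numerator is `1 + offDiag (-z)`, a unit because `-z` is also in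
the disk. -/
lemma isUnit_diskEmbedding {z : A} (hz : ‖z‖ < 1) : IsUnit (diskEmbedding z) := by
  have hu := isUnit_one_add_offDiag hz
  have h : diskEmbedding z = (1 + offDiag (-z)) * Ring.inverse (1 + offDiag z) := by
    rw [diskEmbedding_eq hz, map_neg,
      show 1 + -offDiag z = (2 : ℝ) • (1 : MatrixTwo A) - (1 + offDiag z) by
        rw [two_smul]; abel,
      sub_mul, Ring.mul_inverse_cancel _ hu, smul_mul_assoc, one_mul]
  rw [h]
  exact (isUnit_one_add_offDiag (by rwa [norm_neg])).mul hu.ringInverse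

lemma isSelfAdjoint_diskEmbedding {z : A} (hz : ‖z‖ < 1) : IsSelfAdjoint (diskEmbedding z) := by
  rw [diskEmbedding_eq hz]
  refine IsSelfAdjoint.sub (IsSelfAdjoint.smul (IsSelfAdjoint.all _) ?_) (IsSelfAdjoint.one _)
  rw [isSelfAdjoint_iff, ← Ring.inverse_star, star_add, star_one, (isSelfAdjoint_offDiag z).star_eq]

lemma diskEmbedding_zero : diskEmbedding (0 : A) = 1 := by
  rw [diskEmbedding_eq (by simp), map_zero, add_zero, Ring.inverse_one, two_smul,
    add_sub_cancel_right]

lemma offDiag_injective : Function.Injective (offDiag : A → MatrixTwo A) :=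
  fun z w h => by simpa using congrArg (fun M => M.entry 1 0) h

lemma diskEmbedding_injOn : Set.InjOn (diskEmbedding (A := A)) {z | ‖z‖ < 1} := by
  intro z hz w hw h
  rw [diskEmbedding_eq hz, diskEmbedding_eq hw, sub_left_inj] at h
  have h' := smul_right_injective _ (two_ne_zero (α := ℝ)) h
  have h2 := congrArg Ring.inverse h'
  rw [Ring.inverse_inverse (isUnit_one_add_offDiag hz),
    Ring.inverse_inverse (isUnit_one_add_offDiag hw)] at h2
  exact offDiag_injective (add_left_cancel h2)

lemma contDiff_diskEmbedding_comp {δ : ℝ → A} (hδ : ContDiff ℝ 2 δ) (h : ∀ t, ‖δ t‖ < 1) :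
    ContDiff ℝ 2 fun t => diskEmbedding (δ t) := by
  simp only [fun t => diskEmbedding_eq (h t)]
  have h1 : ContDiff ℝ 2 fun t => 1 + offDiag (δ t) :=
    contDiff_const.add (hδ.continuousLinearMap_comp offDiag)
  refine ContDiff.sub (ContDiff.const_smul _ ?_) contDiff_const
  refine contDiff_iff_contDiffAt.mpr fun t => ?_
  obtain ⟨u, hu⟩ := isUnit_one_add_offDiag (h t)
  have h2 := contDiffAt_ringInverse ℝ (n := 2) u
  rw [hu] at h2
  exact h2.comp t h1.contDiffAt

/-- A geodesic of the disk is determined by its values at `0` and `1` if it starts at `0`. -/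
lemma IsGeodesic.eq_of_eq_zero {δ₁ δ₂ : ℝ → A} (h₁ : IsGeodesic δ₁) (h₂ : IsGeodesic δ₂)
    (h0₁ : δ₁ 0 = 0) (h0₂ : δ₂ 0 = 0) (h : δ₁ 1 = δ₂ 1) : δ₁ = δ₂ := by
  have := SatisfiesGeodesicEquation.eq_of_eq_one
    (γ₁ := fun t => diskEmbedding (δ₁ t)) (γ₂ := fun t => diskEmbedding (δ₂ t))
    h₁.geodesic_equation h₂.geodesic_equation
    (contDiff_diskEmbedding_comp h₁.contDiff h₁.norm_lt_one)
    (contDiff_diskEmbedding_comp h₂.contDiff h₂.norm_lt_one)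
    (fun t => isUnit_diskEmbedding (h₁.norm_lt_one t))
    (fun t => isUnit_diskEmbedding (h₂.norm_lt_one t))
    (fun t => isSelfAdjoint_diskEmbedding (h₁.norm_lt_one t))
    (fun t => isSelfAdjoint_diskEmbedding (h₂.norm_lt_one t))
    (by rw [h0₁, diskEmbedding_zero]) (by rw [h0₂, diskEmbedding_zero]) (by rw [h])
  funext t
  exact diskEmbedding_injOn (h₁.norm_lt_one t) (h₂.norm_lt_one t) (congrFun this t)

/-- If `|x| > ‖z‖`, then `x - Z = x (1 + offDiag (-x⁻¹ z))`, which is invertible because `-x⁻¹ z`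
lies in the disk. -/
lemma spectrum_offDiag_subset (z : A) :
    spectrum ℝ (offDiag z) ⊆ {x | |x| ≤ ‖z‖} := by
  intro x hx
  by_contra hlt
  simp only [Set.mem_ofPred_eq, not_le] at hlt
  have hx0 : x ≠ 0 := by
    rintro rfl
    simp only [abs_zero] at hlt
    linarith [norm_nonneg z]
  refine spectrum.mem_iff.mp hx ?_
  have h1 : ‖-x⁻¹ • z‖ < 1 := by
    rw [norm_smul, norm_neg, norm_inv, Real.norm_eq_abs, inv_mul_lt_one₀ (abs_pos.mpr hx0)]
    exact hlt
  have h2 : algebraMap ℝ _ x - offDiag z = x • (1 + offDiag (-x⁻¹ • z)) := by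
    rw [Algebra.algebraMap_eq_smul_one, map_smul, smul_add, smul_smul]
    simp [hx0, sub_eq_add_neg]
  rw [h2]
  exact (isUnit_one_add_offDiag h1).smul (Units.mk0 x hx0)

lemma spectrum_offDiag_subset_Ioo {z : A} (hz : ‖z‖ < 1) :
    spectrum ℝ (offDiag z) ⊆ Set.Ioo (-1) 1 := fun _ hx =>
  abs_lt.mp ((spectrum_offDiag_subset z hx).trans_lt hz)

end OffDiag

/-! ### The geodesic from the origin through a point of the disk -/

section Flow

set_option linter.unusedSectionVars false

variable {A : Type*} [CStarAlgebra A] [PartialOrder A] [StarOrderedRing A]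

/-- The symmetry `diag(1, -1)` of `M₂(A)`. -/
noncomputable def signature (A : Type*) [CStarAlgebra A] [PartialOrder A] [StarOrderedRing A] :
    unitary (MatrixTwo A) :=
  ⟨MatrixTwo.mk 1 0 0 (-1), by
    rw [Unitary.mem_iff]
    constructor <;> refine MatrixTwo.ext fun i j => ?_ <;> rw [MatrixTwo.entry_mul] <;>
      fin_cases i <;> fin_cases j <;> simp [MatrixTwo.entry_one]⟩

lemma signature_conj_entry (M : MatrixTwo A) :
    Unitary.conjStarAlgAut ℝ _ (signature A) M =
      MatrixTwo.mk (M.entry 0 0) (-M.entry 0 1) (-M.entry 1 0) (M.entry 1 1) := by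
  rw [Unitary.conjStarAlgAut_apply]
  refine MatrixTwo.ext fun i j => ?_
  simp only [MatrixTwo.entry_mul]
  fin_cases i <;> fin_cases j <;> simp [signature]

/-- An odd function of an off-diagonal matrix is off-diagonal. -/
lemma offDiag_entry_cfc {f : ℝ → ℝ} (hodd : ∀ x, f (-x) = -f x) (z : A)
    (hf : ContinuousOn f (spectrum ℝ (offDiag z))) :
    offDiag ((cfc f (offDiag z)).entry 1 0) = cfc f (offDiag z) := by
  have hz := isSelfAdjoint_offDiag z
  -- Conjugation by `diag(1, -1)` sends `Z` to `-Z`, hence `f(Z)` to `-f(Z)`; but it fixes diagonal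
  -- entries, which therefore vanish.
  have hconj : Unitary.conjStarAlgAut ℝ _ (signature A) (offDiag z) = -offDiag z := by
    rw [signature_conj_entry]
    refine MatrixTwo.ext fun i j => ?_
    fin_cases i <;> fin_cases j <;> simp [offDiag_apply]
  have hmap := StarAlgHomClass.map_cfc (S := ℝ) (Unitary.conjStarAlgAut ℝ _ (signature A)) f
    (offDiag z) hf
    (by
      rw [show ⇑(Unitary.conjStarAlgAut ℝ _ (signature A)) = fun x => _ from
        funext fun x => Unitary.conjStarAlgAut_apply _ x]
      fun_prop) hz (by rw [hconj]; exact hz.neg)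
  have hneg : cfc f (-offDiag z) = -cfc f (offDiag z) := by
    have hf' : ContinuousOn f ((fun x => -x) '' spectrum ℝ (offDiag z)) := by
      have h1 : ContinuousOn (fun x => -f (-x)) ((fun x => -x) '' spectrum ℝ (offDiag z)) := by
        refine (hf.comp continuous_neg.continuousOn ?_).neg
        rintro _ ⟨x, hx, rfl⟩
        simpa using hx
      refine h1.congr fun x _ => ?_
      simp only [hodd, neg_neg]
    rw [← cfc_comp_neg f (offDiag z) hf', ← cfc_neg]
    simp only [hodd]
  rw [hconj, hneg, signature_conj_entry] at hmap
  have hsa : IsSelfAdjoint (cfc f (offDiag z)) := cfc_predicate f _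
  generalize cfc f (offDiag z) = M at hmap hsa
  have : IsAddTorsionFree A := .of_isTorsionFree ℝ A
  have h0 : M.entry 0 0 = 0 := by
    have := congrArg (fun M => M.entry 0 0) hmap
    exact (self_eq_neg (G := A)).mp (by simpa using this)
  have h1 : M.entry 1 1 = 0 := by
    have := congrArg (fun M => M.entry 1 1) hmap
    exact (self_eq_neg (G := A)).mp (by simpa using this)
  have h2 : star (M.entry 1 0) = M.entry 0 1 := by
    rw [← MatrixTwo.entry_star, hsa.star_eq]
  refine MatrixTwo.ext fun i j => ?_
  fin_cases i <;> fin_cases j <;> simp [offDiag_apply, h0, h1, h2]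

/-- The geodesic of the disk with value `0` at `0` and `z` at `1`. -/
noncomputable def diskFlow (z : A) (t : ℝ) : A := (cfc (tanhFlow t) (offDiag z)).entry 1 0

lemma continuousOn_tanhFlow_spectrum {z : A} (hz : ‖z‖ < 1) (t : ℝ) :
    ContinuousOn (tanhFlow t) (spectrum ℝ (offDiag z)) :=
  (continuousOn_tanhFlow t).mono (spectrum_offDiag_subset_Ioo hz)

lemma offDiag_diskFlow {z : A} (hz : ‖z‖ < 1) (t : ℝ) :
    offDiag (diskFlow z t) = cfc (tanhFlow t) (offDiag z) :=
  offDiag_entry_cfc (tanhFlow_neg_right t) z (continuousOn_tanhFlow_spectrum hz t)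

lemma diskFlow_one {z : A} (hz : ‖z‖ < 1) : diskFlow z 1 = z := by
  have h : cfc (tanhFlow 1) (offDiag z) = offDiag z := by
    rw [cfc_congr (f := tanhFlow 1) (g := id) fun x hx =>
        tanhFlow_one (spectrum_offDiag_subset_Ioo hz hx),
      cfc_id ℝ _ (isSelfAdjoint_offDiag z)]
  rw [diskFlow, h, offDiag_one_zero]

lemma diskFlow_zero (z : A) : diskFlow z 0 = 0 := by
  have h : tanhFlow 0 = fun _ => 0 := by funext x; simp [tanhFlow]
  rw [diskFlow, h, cfc_const_zero, MatrixTwo.entry_zero]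

lemma diskFlow_neg (z : A) (t : ℝ) : diskFlow z (-t) = -diskFlow z t := by
  have h : tanhFlow (-t) = fun x => -tanhFlow t x := funext (tanhFlow_neg_left t)
  rw [diskFlow, diskFlow, h, cfc_neg, MatrixTwo.entry_neg]

lemma norm_diskFlow_lt_one (z : A) (t : ℝ) : ‖diskFlow z t‖ < 1 :=
  (MatrixTwo.norm_entry_le _ 1 0).trans_lt <|
    norm_cfc_lt one_pos fun x _ => abs_tanhFlow_lt_one t x

/-- The initial velocity of the geodesic from `0` to `z`, in the matrix picture. -/
noncomputable def diskVelocity (z : A) : MatrixTwo A :=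
  cfc (fun x => -2 * Real.artanh x) (offDiag z)

lemma exp_smul_diskVelocity {z : A} (hz : ‖z‖ < 1) (t : ℝ) :
    NormedSpace.exp (t • diskVelocity z) =
      cfc (fun x => Real.exp (-2 * (t * Real.artanh x))) (offDiag z) := by
  have hs := isSelfAdjoint_offDiag z
  have hc : ContinuousOn Real.artanh (spectrum ℝ (offDiag z)) :=
    continuousOn_artanh.mono (spectrum_offDiag_subset_Ioo hz)
  have hc' : ContinuousOn (fun x => -2 * Real.artanh x) (spectrum ℝ (offDiag z)) :=
    continuousOn_const.mul hc
  rw [diskVelocity, ← cfc_const_mul t _ _ hc',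
    ← CFC.real_exp_eq_normedSpace_exp (cfc_predicate _ _),
    ← cfc_comp' Real.exp (fun x => t * (-2 * Real.artanh x)) _ Real.continuous_exp.continuousOn
      (continuousOn_const.mul hc')]
  refine cfc_congr fun x _ => ?_
  ring_nf

/-- Both `1 + Φ(δ t)` and `1 + exp(tV)` are `2` times the inverse of `1 + offDiag (δ t)`, so they
agree. -/
lemma diskEmbedding_diskFlow {z : A} (hz : ‖z‖ < 1) (t : ℝ) :
    diskEmbedding (diskFlow z t) = NormedSpace.exp (t • diskVelocity z) := by
  have hs := isSelfAdjoint_offDiag z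
  have hc : ContinuousOn Real.artanh (spectrum ℝ (offDiag z)) :=
    continuousOn_artanh.mono (spectrum_offDiag_subset_Ioo hz)
  have hn := norm_diskFlow_lt_one z t
  have h1 : (1 + offDiag (diskFlow z t)) * (1 + NormedSpace.exp (t • diskVelocity z)) =
      (2 : ℝ) • 1 := by
    have hc1 := continuousOn_tanhFlow_spectrum hz t
    have hc2 : ContinuousOn (fun x => Real.exp (-2 * (t * Real.artanh x)))
        (spectrum ℝ (offDiag z)) := by fun_prop
    rw [offDiag_diskFlow hz, exp_smul_diskVelocity hz, ← cfc_const_one ℝ (offDiag z) hs,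
      ← cfc_add .., ← cfc_add .., ← cfc_mul ..,
      cfc_congr (f := fun x => (1 + tanhFlow t x) * _) (g := fun _ => (2 : ℝ)) fun x _ =>
        one_add_tanh_mul _,
      cfc_const_one ℝ (offDiag z) hs, cfc_const _ _ hs, Algebra.algebraMap_eq_smul_one]
  have h2 := one_add_offDiag_mul hn
  rw [← h1] at h2
  have h3 := (isUnit_one_add_offDiag hn).mul_left_cancel h2
  rw [add_comm] at h3
  exact add_left_cancel h3

lemma isUnit_one_add_exp_smul_diskVelocity {z : A} (hz : ‖z‖ < 1) (t : ℝ) :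
    IsUnit (1 + NormedSpace.exp (t • diskVelocity z)) := by
  have hn := norm_diskFlow_lt_one z t
  rw [← diskEmbedding_diskFlow hz, add_comm]
  refine ⟨⟨_, (1 / 2 : ℝ) • (1 + offDiag (diskFlow z t)), ?_, ?_⟩, rfl⟩
  · rw [mul_smul_comm, diskEmbedding_add_one_mul hn, smul_smul]; norm_num
  · rw [smul_mul_assoc, one_add_offDiag_mul hn, smul_smul]; norm_num

/-- Expresses the flow through the exponential and inversion, which makes its smoothness in `t`
visible. -/
lemma diskFlow_eq_entry {z : A} (hz : ‖z‖ < 1) (t : ℝ) :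
    diskFlow z t =
      (2 : ℝ) • (Ring.inverse (1 + NormedSpace.exp (t • diskVelocity z))).entry 1 0 := by
  have hn := norm_diskFlow_lt_one z t
  have hu := isUnit_one_add_exp_smul_diskVelocity hz t
  have h2 := congrArg (· * Ring.inverse (1 + NormedSpace.exp (t • diskVelocity z)))
    (one_add_offDiag_mul hn)
  rw [diskEmbedding_diskFlow hz, add_comm (NormedSpace.exp _)] at h2
  simp only [mul_assoc, Ring.mul_inverse_cancel _ hu, mul_one, smul_mul_assoc, one_mul] at h2
  simpa [MatrixTwo.entry_one] using congrArg (fun M => M.entry 1 0) h2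

lemma contDiff_diskFlow {z : A} (hz : ‖z‖ < 1) : ContDiff ℝ 2 (diskFlow z) := by
  have h : diskFlow z = fun t =>
      MatrixTwo.lowerLeft ((2 : ℝ) • Ring.inverse (1 + NormedSpace.exp (t • diskVelocity z))) := by
    funext t
    rw [diskFlow_eq_entry hz]
    rfl
  rw [h]
  refine ContDiff.continuousLinearMap_comp _ (ContDiff.const_smul _ ?_)
  refine contDiff_iff_contDiffAt.mpr fun t => ?_
  obtain ⟨u, hu⟩ := isUnit_one_add_exp_smul_diskVelocity hz t
  have h2 := contDiffAt_ringInverse ℝ (n := 2) u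
  rw [hu] at h2
  exact h2.comp t (contDiff_const.add (contDiff_exp_smul _)).contDiffAt

lemma isGeodesic_diskFlow {z : A} (hz : ‖z‖ < 1) : IsGeodesic (diskFlow z) where
  norm_lt_one := norm_diskFlow_lt_one z
  contDiff := contDiff_diskFlow hz
  geodesic_equation := by
    have h := satisfiesGeodesicEquation_exp_smul (diskVelocity z)
    rw [← funext (diskEmbedding_diskFlow hz)] at h
    exact h

/-- `z` is moved by the geodesic flow towards the phase of `z`. -/
lemma norm_diskFlow_mul_abs_sub_le {z : A} (hz : ‖z‖ < 1) {t : ℝ} (ht : 0 < t) :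
    ‖diskFlow z t * CFC.abs z - z‖ ≤ 2 / t := by
  have hs := isSelfAdjoint_offDiag z
  -- Since `Z² = diag(z*z, zz*)`, the lower left entry of `tanh(t artanh Z) |Z|` is `δ(t)|z|`.
  have habs : CFC.abs (offDiag z) = MatrixTwo.mk (CFC.abs z) 0 0 (CFC.abs (star z)) := by
    refine CFC.sqrt_unique ?_ (MatrixTwo.mk_diag_nonneg (CFC.abs_nonneg _) (CFC.abs_nonneg _))
    refine MatrixTwo.ext fun i j => ?_
    simp only [MatrixTwo.entry_mul]
    fin_cases i <;> fin_cases j <;> simp [offDiag_apply, CFC.abs_mul_abs]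
  have hc := continuousOn_tanhFlow_spectrum hz t
  have hcfc : cfc (tanhFlow t) (offDiag z) * CFC.abs (offDiag z) - offDiag z =
      cfc (fun x => tanhFlow t x * |x| - x) (offDiag z) := by
    rw [cfc_sub .., cfc_mul .., cfc_id' ℝ _ hs, CFC.abs_eq_cfc_norm (offDiag z) hs]
    rfl
  have hentry : diskFlow z t * CFC.abs z - z =
      (cfc (tanhFlow t) (offDiag z) * CFC.abs (offDiag z) - offDiag z).entry 1 0 := by
    rw [habs, MatrixTwo.entry_sub, MatrixTwo.entry_mul]
    simp [diskFlow]
  rw [hentry, hcfc]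
  refine (MatrixTwo.norm_entry_le _ 1 0).trans (norm_cfc_le (by positivity) fun x hx => ?_)
  exact abs_tanhFlow_mul_abs_sub_le ((spectrum_offDiag_subset z hx).trans_lt hz) ht

/-- The scalar bound `tanhFlow t x ^ 2 ≤ C x ^ 2` on the spectrum becomes a matrix inequality, whose
upper left entry is the claim. It forces `δ(t)` to vanish wherever `z` does in a representation. -/
lemma exists_star_diskFlow_mul_self_le {z : A} (hz : ‖z‖ < 1) (t : ℝ) :
    ∃ C : ℝ, star (diskFlow z t) * diskFlow z t ≤ C • (star z * z) := by
  have hs := isSelfAdjoint_offDiag z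
  have hsq : ∀ w : A, (offDiag w * offDiag w).entry 0 0 = star w * w := fun w => by
    simp [MatrixTwo.entry_mul, offDiag_apply]
  have hc := continuousOn_tanhFlow_spectrum hz t
  set C := (2 * |t| / (1 - ‖z‖)) ^ 2
  have h : offDiag (diskFlow z t) * offDiag (diskFlow z t) ≤ C • (offDiag z * offDiag z) := by
    rw [offDiag_diskFlow hz, ← cfc_mul ..]
    nth_rewrite 2 3 [← cfc_id' ℝ (offDiag z) hs]
    rw [← cfc_mul .., ← cfc_const_mul ..]
    refine cfc_mono fun x hx => ?_
    have h1 := abs_tanhFlow_le t (spectrum_offDiag_subset z hx) hz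
    have h2 := mul_self_le_mul_self (abs_nonneg _) h1
    rw [abs_mul_abs_self] at h2
    refine h2.trans_eq ?_
    rw [← abs_mul_abs_self x]
    ring
  refine ⟨C, ?_⟩
  have h1 := MatrixTwo.entry_nonneg (sub_nonneg.mpr h) 0
  rw [MatrixTwo.entry_sub, MatrixTwo.entry_smul, hsq, hsq] at h1
  exact sub_nonneg.mp h1

end Flow

/-! ### Polar decomposition of bounded operators -/

section Polar

variable {H : Type*} [NormedAddCommGroup H] [InnerProductSpace ℂ H] [CompleteSpace H]
  {T : H →L[ℂ] H}

lemma inner_abs_apply_abs_apply (T : H →L[ℂ] H) (x y : H) :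
    inner ℂ (CFC.abs T x) (CFC.abs T y) = inner ℂ (T x) (T y) := by
  have hs : ContinuousLinearMap.adjoint (CFC.abs T) = CFC.abs T :=
    (IsSelfAdjoint.of_nonneg (CFC.abs_nonneg T)).star_eq
  have h : CFC.abs T (CFC.abs T y) = ContinuousLinearMap.adjoint T (T y) :=
    congrArg (fun S : H →L[ℂ] H => S y) (CFC.abs_mul_abs T)
  rw [← ContinuousLinearMap.adjoint_inner_right, hs, h, ContinuousLinearMap.adjoint_inner_right]

lemma abs_apply_eq_zero_iff (T : H →L[ℂ] H) (x : H) : CFC.abs T x = 0 ↔ T x = 0 := by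
  rw [← inner_self_eq_zero (𝕜 := ℂ), inner_abs_apply_abs_apply, inner_self_eq_zero]

/-- A closed subspace which contains the range of `|T|` and the kernel of `T` is everything. -/
lemma mem_of_range_abs_of_ker {S : Submodule ℂ H} (hS : IsClosed (S : Set H))
    (hrange : ∀ x, CFC.abs T x ∈ S) (hker : ∀ x, T x = 0 → x ∈ S) (x : H) : x ∈ S := by
  have hs : ContinuousLinearMap.adjoint (CFC.abs T) = CFC.abs T :=
    (IsSelfAdjoint.of_nonneg (CFC.abs_nonneg T)).star_eq
  -- A vector orthogonal to `S` is killed by `|T|`, hence by `T`; it then lies in `S` and is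
  -- orthogonal to itself.
  have htop : S.topologicalClosure = ⊤ := by
    rw [Submodule.topologicalClosure_eq_top_iff, Submodule.eq_bot_iff]
    intro y hy
    have h1 : CFC.abs T y = 0 := by
      rw [← inner_self_eq_zero (𝕜 := ℂ), ← ContinuousLinearMap.adjoint_inner_right, hs]
      exact (Submodule.mem_orthogonal' _ _).mp hy _ (hrange _)
    exact inner_self_eq_zero.mp
      ((Submodule.mem_orthogonal' _ _).mp hy _ (hker y ((abs_apply_eq_zero_iff T y).mp h1)))
  rw [hS.submodule_topologicalClosure_eq] at htop
  rw [htop]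
  trivial

lemma eq_of_eq_on_range_abs_of_ker {R S : H →L[ℂ] H}
    (hrange : ∀ x, R (CFC.abs T x) = S (CFC.abs T x))
    (hker : ∀ x, T x = 0 → R x = S x) : R = S := by
  ext x
  exact mem_of_range_abs_of_ker (T := T) (S := LinearMap.eqLocus R.toLinearMap S.toLinearMap)
    (isClosed_eq R.continuous S.continuous) hrange hker x

/-- The uniform bound gives equicontinuity, so the vectors where convergence holds form a closed
subspace. -/
lemma tendsto_of_range_abs_of_ker {ι : Type*} {l : Filter ι} {F : ι → H →L[ℂ] H} {f : H →L[ℂ] H}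
    {C : ℝ} (hF : ∀ i, ‖F i‖ ≤ C)
    (hrange : ∀ x, Tendsto (fun i => F i (CFC.abs T x)) l (𝓝 (f (CFC.abs T x))))
    (hker : ∀ x, T x = 0 → Tendsto (fun i => F i x) l (𝓝 (f x))) (x : H) :
    Tendsto (fun i => F i x) l (𝓝 (f x)) := by
  let S : Submodule ℂ H :=
    { carrier := {x | Tendsto (fun i => F i x) l (𝓝 (f x))}
      add_mem' := fun {a b} ha hb => by simpa using Tendsto.add ha hb
      zero_mem' := by simpa using tendsto_const_nhds
      smul_mem' := fun c a ha => by simpa using Tendsto.const_smul ha c }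
  have hequi : Equicontinuous fun i => (F i : H → H) := by
    refine (LipschitzWith.uniformEquicontinuous _ C.toNNReal fun i => ?_).equicontinuous
    refine (F i).lipschitz.weaken ?_
    rw [← NNReal.coe_le_coe, coe_nnnorm]
    exact (hF i).trans (Real.le_coe_toNNReal C)
  exact mem_of_range_abs_of_ker (T := T) (S := S)
    (hequi.isClosed_setOfPred_tendsto f.continuous) hrange hker x

lemma IsPolarPart.apply_abs {ω : H →L[ℂ] H} (h : IsPolarPart T ω) (x : H) :
    ω (CFC.abs T x) = T x :=
  (congrArg (fun S : H →L[ℂ] H => S x) h.eq_mul_abs).symm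

lemma IsPolarPart.apply_eq_zero {ω : H →L[ℂ] H} (h : IsPolarPart T ω) {x : H} (hx : T x = 0) :
    ω x = 0 := by
  have : x ∈ LinearMap.ker (ω : H →ₗ[ℂ] H) := by rw [h.ker_eq]; exact hx
  exact this

lemma IsPolarPart.unique {ω₁ ω₂ : H →L[ℂ] H} (h₁ : IsPolarPart T ω₁) (h₂ : IsPolarPart T ω₂) :
    ω₁ = ω₂ :=
  eq_of_eq_on_range_abs_of_ker (T := T) (fun x => by rw [h₁.apply_abs, h₂.apply_abs])
    fun x hx => by rw [h₁.apply_eq_zero hx, h₂.apply_eq_zero hx]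

/-- Testing against the range of `|T|` and `ker T` gives `ω*T = |T|`, so `ω*ω` fixes the range of
`|T|`. Its adjoint form `T*ω = |T|` gives `ker ω ⊆ ker T`. -/
lemma isPolarPart_of_apply {ω : H →L[ℂ] H} (habs : ∀ x, ω (CFC.abs T x) = T x)
    (hker : ∀ x, T x = 0 → ω x = 0) : IsPolarPart T ω := by
  have hs : ContinuousLinearMap.adjoint (CFC.abs T) = CFC.abs T :=
    (IsSelfAdjoint.of_nonneg (CFC.abs_nonneg T)).star_eq
  have hadj : ∀ x, ContinuousLinearMap.adjoint ω (T x) = CFC.abs T x := by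
    intro x
    have key : ∀ y, inner ℂ (ContinuousLinearMap.adjoint ω (T x)) y = inner ℂ (CFC.abs T x) y :=
      mem_of_range_abs_of_ker (T := T)
        (S := LinearMap.eqLocus (innerSL ℂ (ContinuousLinearMap.adjoint ω (T x))).toLinearMap
          (innerSL ℂ (CFC.abs T x)).toLinearMap)
        (isClosed_eq (ContinuousLinearMap.continuous _) (ContinuousLinearMap.continuous _))
        (fun y => by
          change inner ℂ _ _ = inner ℂ _ _
          rw [ContinuousLinearMap.adjoint_inner_left, habs, inner_abs_apply_abs_apply])
        (fun y hy => by
          change inner ℂ _ _ = inner ℂ _ _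
          rw [ContinuousLinearMap.adjoint_inner_left, hker y hy, inner_zero_right,
            ← ContinuousLinearMap.adjoint_inner_right, hs, (abs_apply_eq_zero_iff T y).mpr hy,
            inner_zero_right])
    exact ext_inner_right ℂ key
  have hadj' : star ω * T = CFC.abs T := ContinuousLinearMap.ext hadj
  have hmul : T = ω * CFC.abs T := ContinuousLinearMap.ext fun x => (habs x).symm
  refine ⟨?_, hmul, ?_⟩
  · refine eq_of_eq_on_range_abs_of_ker (T := T) (fun x => ?_) fun x hx => ?_
    · change ω (ContinuousLinearMap.adjoint ω (ω (CFC.abs T x))) = ω (CFC.abs T x)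
      rw [habs, hadj, habs]
    · change ω (ContinuousLinearMap.adjoint ω (ω x)) = ω x
      rw [hker x hx, map_zero, map_zero]
  · ext x
    refine ⟨fun hx => ?_, hker x⟩
    have h1 : star T * ω = CFC.abs T := by
      rw [← star_star ω, ← star_mul, hadj']
      exact hs
    refine (abs_apply_eq_zero_iff T x).mp ?_
    rw [← h1]
    change star T (ω x) = 0
    rw [show ω x = 0 from hx, map_zero]

/-- A bounded sequence of operators which vanishes on the kernel of `T` and converges to `T` after
multiplication with `|T|` converges strongly to the phase of `T`. -/
lemma exists_isPolarPart_tendsto {F : ℕ → H →L[ℂ] H} (hF : ∀ n, ‖F n‖ ≤ 1)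
    (habs : ∀ x, Tendsto (fun n => F n (CFC.abs T x)) atTop (𝓝 (T x)))
    (hker : ∀ n x, T x = 0 → F n x = 0) :
    ∃ ω, IsPolarPart T ω ∧ ∀ x, Tendsto (fun n => F n x) atTop (𝓝 (ω x)) := by
  -- No limit operator is available yet, so the density argument is applied to the differences `F m
  -- - F n` with target `0`, proving the Cauchy property.
  have hdiff : ∀ x, Tendsto (fun p : ℕ × ℕ => (F p.1 - F p.2) x) (atTop ×ˢ atTop)
      (𝓝 ((0 : H →L[ℂ] H) x)) := by
    refine tendsto_of_range_abs_of_ker (T := T) (C := 2) (fun p => ?_) (fun x => ?_) fun x hx => ?_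
    · exact (norm_sub_le _ _).trans (by linarith [hF p.1, hF p.2])
    · simpa using ((habs x).comp tendsto_fst).sub ((habs x).comp tendsto_snd)
    · simp [hker _ x hx]
  have hlim : ∀ x, ∃ y, Tendsto (fun n => F n x) atTop (𝓝 y) := by
    intro x
    refine cauchySeq_tendsto_of_complete ?_
    rw [cauchySeq_iff_tendsto_dist_atTop_0, ← prod_atTop_atTop_eq]
    simpa [dist_eq_norm] using (hdiff x).norm
  choose g hg using hlim
  let ω : H →L[ℂ] H := continuousLinearMapOfTendsto F (tendsto_pi_nhds.mpr hg)
  have hω : ∀ x, Tendsto (fun n => F n x) atTop (𝓝 (ω x)) := hg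
  refine ⟨ω, isPolarPart_of_apply (fun x => ?_) fun x hx => ?_, hω⟩
  · exact tendsto_nhds_unique (hω _) (habs x)
  · refine tendsto_nhds_unique (hω x) ?_
    simp [hker _ x hx]

end Polar

/-! ### Limit points of geodesics in the universal representation -/

section Limit

set_option linter.unusedSectionVars false

lemma sotTendsto_iff {ι H : Type*} [NormedAddCommGroup H] [InnerProductSpace ℂ H]
    {T : ι → H →L[ℂ] H} {l : Filter ι} {S : H →L[ℂ] H} :
    SOTTendsto T l S ↔ ∀ x, Tendsto (fun i => T i x) l (𝓝 (S x)) :=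
  PointwiseConvergenceCLM.tendsto_iff_forall_tendsto

variable {A : Type*} [CStarAlgebra A] [PartialOrder A] [StarOrderedRing A]
  {H : Type*} [NormedAddCommGroup H] [InnerProductSpace ℂ H] [CompleteSpace H]
  (π : A →⋆ₐ[ℂ] (H →L[ℂ] H))

lemma abs_map_starAlgHom (z : A) : CFC.abs (π z) = π (CFC.abs z) := by
  refine CFC.sqrt_unique ?_ ?_
  · rw [← map_mul, CFC.abs_mul_abs, map_mul, map_star]
  · obtain ⟨s, hs⟩ := CStarAlgebra.nonneg_iff_eq_star_mul_self.mp (CFC.abs_nonneg z)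
    rw [hs, map_mul, map_star]
    exact star_mul_self_nonneg _

lemma norm_map_starAlgHom_le (a : A) : ‖π a‖ ≤ ‖a‖ :=
  NonUnitalStarAlgHom.norm_apply_le π a

lemma norm_map_diskFlow_le (z : A) (t : ℝ) : ‖π (diskFlow z t)‖ ≤ 1 :=
  (norm_map_starAlgHom_le π _).trans (norm_diskFlow_lt_one z t).le

lemma tendsto_map_diskFlow_abs {z : A} (hz : ‖z‖ < 1) (x : H) :
    Tendsto (fun t => π (diskFlow z t) (CFC.abs (π z) x)) atTop
      (𝓝 (π z x)) := by
  rw [tendsto_iff_norm_sub_tendsto_zero]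
  have hlim : Tendsto (fun t : ℝ => 2 / t * ‖x‖) atTop (𝓝 0) := by
    simpa using (tendsto_const_nhds.div_atTop tendsto_id).mul_const ‖x‖
  refine squeeze_zero' (.of_forall fun t => norm_nonneg _) ?_ hlim
  filter_upwards [eventually_gt_atTop 0] with t ht
  have h : π (diskFlow z t) (CFC.abs (π z) x) - π z x =
      π (diskFlow z t * CFC.abs z - z) x := by
    rw [abs_map_starAlgHom, map_sub, map_mul]
    rfl
  rw [h]
  refine (ContinuousLinearMap.le_opNorm _ _).trans ?_
  gcongr
  exact (norm_map_starAlgHom_le π _).trans (norm_diskFlow_mul_abs_sub_le hz ht)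

/-- Write `C z*z - δ(t)*δ(t) = s*s`. Pairing with `x ∈ ker π(z)` gives `-‖π(δ(t))x‖² = ‖π(s)x‖²`, so
both sides vanish. -/
lemma map_diskFlow_apply_eq_zero {z : A} (hz : ‖z‖ < 1) (t : ℝ) {x : H}
    (hx : π z x = 0) : π (diskFlow z t) x = 0 := by
  obtain ⟨C, hC⟩ := exists_star_diskFlow_mul_self_le hz t
  obtain ⟨s, hs⟩ := CStarAlgebra.nonneg_iff_eq_star_mul_self.mp (sub_nonneg.mpr hC)
  have hsq : ∀ a : A, inner ℂ x (π (star a * a) x) =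
      inner ℂ (π a x) (π a x) := fun a => by
    rw [map_mul, map_star, ContinuousLinearMap.star_eq_adjoint, ContinuousLinearMap.mul_def,
      ContinuousLinearMap.comp_apply, ContinuousLinearMap.adjoint_inner_right]
  have h1 : π (star z * z) x = 0 := by
    rw [map_mul, ContinuousLinearMap.mul_def, ContinuousLinearMap.comp_apply, hx, map_zero]
  have h2 := congrArg (fun a => inner ℂ x (π a x)) hs
  have h3 : π (C • (star z * z)) x = 0 := by
    rw [← Complex.coe_smul, map_smul]
    change (C : ℂ) • π (star z * z) x = 0
    rw [h1, smul_zero]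
  simp only [map_sub, sub_apply, inner_sub_right, hsq, h3, inner_zero_right,
    inner_self_eq_norm_sq_to_K] at h2
  have h4 : -‖π (diskFlow z t) x‖ ^ 2 = ‖π s x‖ ^ 2 := by
    rw [zero_sub] at h2
    exact_mod_cast h2
  have h5 : ‖π (diskFlow z t) x‖ ^ 2 = 0 := by
    nlinarith [sq_nonneg ‖π (diskFlow z t) x‖, sq_nonneg ‖π s x‖]
  simpa using h5

/-- An operator commuting with every `π(a)` also commutes with strong limits of such operators. -/
lemma mem_centralizer_centralizer_of_tendsto {F : ℕ → A} {ω : H →L[ℂ] H}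
    (h : ∀ x, Tendsto (fun n => π (F n) x) atTop (𝓝 (ω x))) :
    ω ∈ StarSubalgebra.centralizer ℂ
      (StarSubalgebra.centralizer ℂ (Set.range π) : Set (H →L[ℂ] H)) := by
  have hcomm : ∀ g : H →L[ℂ] H,
      (∀ a, π a * g = g * π a) → g * ω = ω * g := by
    intro g hg
    ext1 x
    refine tendsto_nhds_unique ((g.continuous.tendsto _).comp (h x)) ?_
    refine (h (g x)).congr fun n => ?_
    exact congrArg (fun S : H →L[ℂ] H => S x) (hg (F n))
  rw [StarSubalgebra.mem_centralizer_iff]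
  intro g hg
  refine ⟨hcomm g fun a => ?_, hcomm (star g) fun a => ?_⟩
  · exact ((StarSubalgebra.mem_centralizer_iff ℂ).mp hg _ ⟨a, rfl⟩).1
  · exact ((StarSubalgebra.mem_centralizer_iff ℂ).mp (star_mem hg) _ ⟨a, rfl⟩).1

lemma exists_isPolarPart_mem_centralizer_centralizer {z : A} (hz : ‖z‖ < 1) :
    ∃ ω ∈ StarSubalgebra.centralizer ℂ
      (StarSubalgebra.centralizer ℂ (Set.range π) : Set (H →L[ℂ] H)), IsPolarPart (π z) ω := by
  -- Integer times suffice to construct `ω`; convergence along real `t` is proved once `ω` is known.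
  obtain ⟨ω, hω, hlim⟩ := exists_isPolarPart_tendsto (T := π z)
    (F := fun n : ℕ => π (diskFlow z n))
    (fun n => norm_map_diskFlow_le π z n)
    (fun x => (tendsto_map_diskFlow_abs π hz x).comp tendsto_natCast_atTop_atTop)
    (fun n x hx => map_diskFlow_apply_eq_zero π hz n hx)
  exact ⟨ω, mem_centralizer_centralizer_of_tendsto π hlim, hω⟩

lemma tendsto_map_diskFlow {z : A} (hz : ‖z‖ < 1)
    {ω : H →L[ℂ] H} (hω : IsPolarPart (π z) ω)
    (x : H) :
    Tendsto (fun t => π (diskFlow z t) x) atTop (𝓝 (ω x)) := by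
  refine tendsto_of_range_abs_of_ker (T := π z) (norm_map_diskFlow_le π z)
    (fun x => ?_) (fun x hx => ?_) x
  · rw [hω.apply_abs]
    exact tendsto_map_diskFlow_abs π hz x
  · simp only [map_diskFlow_apply_eq_zero π hz _ hx, hω.apply_eq_zero hx]
    exact tendsto_const_nhds

end Limit

end PoincareDisk

theorem theorem7p1 {A : Type*} [CStarAlgebra A] [PartialOrder A] [StarOrderedRing A]
    (z : A) (hz : ‖z‖ < 1) :
    (∃! δ : ℝ → A, PoincareDisk.IsGeodesic δ ∧ δ 0 = 0 ∧ δ 1 = z) ∧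
    (∃! ω : PoincareDisk.UniversalSpace A →L[ℂ] PoincareDisk.UniversalSpace A,
      ω ∈ PoincareDisk.enveloping A ∧
      PoincareDisk.IsPolarPart (PoincareDisk.universalRep A z) ω) ∧
    ∀ δ : ℝ → A, PoincareDisk.IsGeodesic δ → δ 0 = 0 → δ 1 = z →
      ∀ ω ∈ PoincareDisk.enveloping A,
        PoincareDisk.IsPolarPart (PoincareDisk.universalRep A z) ω →
          PoincareDisk.SOTTendsto (fun t => PoincareDisk.universalRep A (δ t)) atTop ω ∧
          PoincareDisk.SOTTendsto (fun t => PoincareDisk.universalRep A (δ t)) atBot (-ω) := by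
  have hflow := PoincareDisk.isGeodesic_diskFlow hz
  have huniq : ∀ δ : ℝ → A, PoincareDisk.IsGeodesic δ → δ 0 = 0 → δ 1 = z →
      δ = PoincareDisk.diskFlow z := fun δ hδ h0 h1 =>
    hδ.eq_of_eq_zero hflow h0 (PoincareDisk.diskFlow_zero z)
      (h1.trans (PoincareDisk.diskFlow_one hz).symm)
  obtain ⟨ω₀, hmem, hω₀⟩ :=
    PoincareDisk.exists_isPolarPart_mem_centralizer_centralizer (PoincareDisk.universalRep A) hz
  refine ⟨⟨PoincareDisk.diskFlow z,
    ⟨hflow, PoincareDisk.diskFlow_zero z, PoincareDisk.diskFlow_one hz⟩,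
    fun δ hδ => huniq δ hδ.1 hδ.2.1 hδ.2.2⟩,
    ⟨ω₀, ⟨hmem, hω₀⟩, fun ω hω => hω.2.unique hω₀⟩, ?_⟩
  intro δ hδ h0 h1 ω _ hω
  rw [huniq δ hδ h0 h1, PoincareDisk.sotTendsto_iff, PoincareDisk.sotTendsto_iff]
  have hlim := PoincareDisk.tendsto_map_diskFlow (PoincareDisk.universalRep A) hz hω
  refine ⟨hlim, fun x => ?_⟩
  -- The flow is odd in `t`, so the limit at `-∞` is minus the limit at `+∞`.
  refine ((hlim x).comp tendsto_neg_atBot_atTop).neg.congr fun t => ?_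
  simp only [Function.comp_apply, PoincareDisk.diskFlow_neg, map_neg, neg_apply,
    neg_neg]
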